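/- Consider the control-affine system $\dot x(t) = g(x(t),u(t),w(t)) := f(x(t),w(t)) + G(x(t))u(t)$ with $f:\mathbb R^{n_x}\times\mathbb R^{n_w}\to\mathbb R^{n_x}$ and $G:\mathbb R^{n_x}\to\mathbb R^{n_x\times n_u}$. Let $U\subseteq\mathbb R^{n_u}$ and $W\subseteq\mathbb R^{n_w}$ be compact and convex, with $U$ having non-empty interior; let $f$ be jointly continuous and locally Lipschitz in $x$, locally uniformly in $w$; and let $G$ be continuously differentiable. For a non-empty compact set $Z\subseteq\mathbb R^{n_x}$ and $c\in\mathbb R^{n_x}$ write $V[Z](c):=\max_{z\in Z}c^{\mathsf T}z$, and for $\nu\in U$ put $$\Gamma_g(\nu,c,Z):=\{\,g(\xi,\nu,\omega)\;:\;\xi\in Z,\ c^{\mathsf T}\xi=V[Z](c),\ \omega\in W\,\}.$$ Let $Y$ assign to each $t\in[t_1,t_2]$ a non-empty compact convex set $Y(t)\subseteq\mathbb R^{n_x}$ such that 1. for every $c\in\mathbb R^{n_x}$ the function $t\mapsto V[Y(t)](c)$ is Lipschitz continuous on $[t_1,t_2]$; 2. for almost every $t\in[t_1,t_2]$ and all $c\in\mathbb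 R^{n_x}$, the time derivative $\dot V[Y(t)](c)$ exists and $$\dot V[Y(t)](c)\ \ge\ \min_{\nu\in U}V[\Gamma_g(\nu,c,Y(t))](c).$$ Then $Y$ is a robust forward invariant tube on $[t_1,t_2]$. That is, there is a measurable, locally integrable feedback law $\mu:[t_1,t_2]\times\mathbb R^{n_x}\to U$ such that, for every locally integrable $w:\mathbb R\to\mathbb R^{n_w}$ with values in $W$ and every absolutely continuous solution $x$ on an interval $[a,b]\subseteq[t_1,t_2]$ of $$\dot x(t)=f(x(t),w(t))+G(x(t))\mu(t,x(t))\quad\text{for a.e. }t\in[a,b],\qquad x(a)\in Y(a),$$ one has $x(t)\in Y(t)$ for all $t\in[a,b]$. -/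

import Mathlib

open Set MeasureTheory

noncomputable section

namespace MinMaxDI

/-- The Euclidean space `ℝⁿ`. -/
abbrev Eu (n : ℕ) : Type := EuclideanSpace ℝ (Fin n)

/-- The support function `V[Z](c) = max {cᵀz | z ∈ Z}` (used for nonempty compact `Z` only, where the
supremum is attained). -/
def supportFn {n : ℕ} (Z : Set (Eu n)) (c : Eu n) : ℝ :=
  sSup ((fun z : Eu n => inner ℝ c z) '' Z)

/-- The right-hand side `g(x,u,w) = f(x,w) + G(x)u` of the control-affine system; the matrix `G(x)`
is given as a linear map. -/
def rhs {nx nu nw : ℕ} (f : Eu nx → Eu nw → Eu nx) (G : Eu nx → (Eu nu →L[ℝ] Eu nx))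
    (x : Eu nx) (u : Eu nu) (w : Eu nw) : Eu nx :=
  f x w + G x u

/-- `Γ_g(ν,c,Z) = {g(ξ,ν,ω) | cᵀξ = V[Z](c), ξ ∈ Z, ω ∈ W}`. -/
def Gam {nx nu nw : ℕ} (f : Eu nx → Eu nw → Eu nx) (G : Eu nx → (Eu nu →L[ℝ] Eu nx))
    (W : Set (Eu nw)) (ν : Eu nu) (c : Eu nx) (Z : Set (Eu nx)) : Set (Eu nx) :=
  {y | ∃ ξ ω, inner ℝ c ξ = supportFn Z c ∧ ξ ∈ Z ∧ ω ∈ W ∧ y = rhs f G ξ ν ω}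

/-- `min_{ν ∈ U} V[Γ_g(ν,c,Z)](c)`. -/
def minMax {nx nu nw : ℕ} (f : Eu nx → Eu nw → Eu nx) (G : Eu nx → (Eu nu →L[ℝ] Eu nx))
    (U : Set (Eu nu)) (W : Set (Eu nw)) (c : Eu nx) (Z : Set (Eu nx)) : ℝ :=
  sInf ((fun ν : Eu nu => supportFn (Gam f G W ν c Z) c) '' U)

/-- `f(x,w)` is locally Lipschitz in `x`, locally uniformly in `w`. -/
def LocLipschitzInState {nx nw : ℕ} (f : Eu nx → Eu nw → Eu nx) : Prop :=
  ∀ (x₀ : Eu nx) (w₀ : Eu nw), ∃ K : NNReal, ∃ A ∈ nhds x₀, ∃ B ∈ nhds w₀,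
    ∀ w ∈ B, LipschitzOnWith K (fun x => f x w) A

/-- The admissible disturbances: locally integrable functions of time with values in `W`. -/
def Disturbance {nw : ℕ} (W : Set (Eu nw)) (w : ℝ → Eu nw) : Prop :=
  LocallyIntegrable w volume ∧ ∀ t, w t ∈ W

/-- `x` is a (Carathéodory) solution on `[a,b]` of `ẋ = f(x,w) + G(x) μ(t,x)`: it is absolutely
continuous and satisfies the equation for almost every time. -/
def IsSolution {nx nu nw : ℕ} (f : Eu nx → Eu nw → Eu nx) (G : Eu nx → (Eu nu →L[ℝ] Eu nx))
    (μ : ℝ → Eu nx → Eu nu) (w : ℝ → Eu nw) (a b : ℝ) (x : ℝ → Eu nx) : Prop :=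
  AbsolutelyContinuousOnInterval x a b ∧
    ∀ᵐ t ∂(volume.restrict (Icc a b)), HasDerivAt x (rhs f G (x t) (μ t (x t)) (w t)) t

/-- `Y` is a robust forward invariant tube on `[t₁,t₂]`: some jointly measurable, locally integrable
feedback law `μ : [t₁,t₂] × ℝⁿ → U` keeps in `Y`, for every admissible disturbance, every
closed-loop solution that starts in `Y` at some time `a ∈ [t₁,t₂]`. -/
def IsRFIT {nx nu nw : ℕ} (f : Eu nx → Eu nw → Eu nx) (G : Eu nx → (Eu nu →L[ℝ] Eu nx))
    (U : Set (Eu nu)) (W : Set (Eu nw)) (t₁ t₂ : ℝ) (Y : ℝ → Set (Eu nx)) : Prop :=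
  ∃ μ : ℝ → Eu nx → Eu nu,
    Measurable (fun p : ℝ × Eu nx => μ p.1 p.2) ∧
    LocallyIntegrableOn (fun p : ℝ × Eu nx => μ p.1 p.2) (Icc t₁ t₂ ×ˢ univ) volume ∧
    (∀ t ∈ Icc t₁ t₂, ∀ x, μ t x ∈ U) ∧
    ∀ w : ℝ → Eu nw, Disturbance W w →
      ∀ a b : ℝ, t₁ ≤ a → a ≤ b → b ≤ t₂ →
        ∀ x : ℝ → Eu nx, IsSolution f G μ w a b x → x a ∈ Y a →
          ∀ t ∈ Icc a b, x t ∈ Y t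

end MinMaxDI

end

/-! Let `q t x` be the metric projection of `x` onto `Y t`, and choose a feedback that nearly
minimizes the worst-case velocity over the supporting face of `Y t` in the outward direction `x - q
t x`. Along a closed-loop solution let `d t` be the distance from `x t` to `Y t`; the aim is `d =
0`.

For each fixed `c` the gap `⟨c, x s⟩ - V[Y s](c)` is at most `‖c‖ * d s`, with equality at `s = t`
for `c = x t - q t (x t)`. So wherever `d` is differentiable, `‖c‖ * d` has the same derivative at
`t` as this gap. The differential inequality, the choice of feedback and a Lipschitz comparison of
the velocities at `x t` and at its projection give `d' ≤ (K + 1) d`. The exceptional null set is the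
same for all `c`, so `c` may depend on `t`.

The same touching argument gives `d t - d s ≤ L (t - s)` for `s ≤ t`, since the support functions
cannot decrease too fast. This one-sided bound makes `d` a linear function minus a monotone one,
which suffices for Grönwall (`eq_zero_of_ae_deriv_le`). The feedback comes from
`exists_measurable_feedback`, the estimates on `d` from `mem_tube_of_isSolution`. -/

namespace MinMaxDI

/-! ### Real analysis: one-sided Grönwall estimates and Lipschitz bounds on compact sets. -/

theorem sub_le_mul_of_ae_hasDerivAt_le {m : ℝ → ℝ} {s t L : ℝ} (hst : s ≤ t)
    (hm : AbsolutelyContinuousOnInterval m s t)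
    (hd : ∀ᵐ τ ∂(volume.restrict (Icc s t)), ∃ v, HasDerivAt m v τ ∧ v ≤ L) :
    m t - m s ≤ L * (t - s) := by
  have h1 : ∫ τ in s..t, deriv m τ ≤ ∫ _ in s..t, L := by
    refine intervalIntegral.integral_mono_ae_restrict hst hm.intervalIntegrable_deriv (by simp) ?_
    filter_upwards [hd] with τ hτ
    obtain ⟨v, hv, hvL⟩ := hτ
    rw [hv.deriv]
    exact hvL
  rw [hm.integral_deriv_eq_sub, intervalIntegral.integral_const, smul_eq_mul] at h1
  linarith

theorem intervalIntegral_deriv_le_of_monotoneOn {h : ℝ → ℝ} {a b : ℝ} (hab : a ≤ b)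
    (hh : MonotoneOn h (Icc a b)) : ∫ τ in a..b, deriv h τ ≤ h b - h a := by
  have h0 : 0 ≤ h b - h a := sub_nonneg.2 (hh (left_mem_Icc.2 hab) (right_mem_Icc.2 hab) hab)
  have := MonotoneOn.intervalIntegral_deriv_mem_uIcc (f := h) (a := a) (b := b)
    (by rwa [uIcc_of_le hab])
  rw [uIcc_of_le h0] at this
  exact this.2

theorem ae_restrict_Icc_mem_Ioo (a b : ℝ) : ∀ᵐ t ∂(volume.restrict (Icc a b)), t ∈ Ioo a b := by
  rw [← restrict_Ioo_eq_restrict_Icc]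
  exact ae_restrict_mem measurableSet_Ioo

/-- An integral Grönwall inequality with zero initial value. -/
theorem eq_zero_of_le_mul_intervalIntegral {d : ℝ → ℝ} {a b K C : ℝ} (hK : 0 < K)
    (hint : IntervalIntegrable d volume a b)
    (hnn : ∀ t ∈ Icc a b, 0 ≤ d t) (hC : ∀ t ∈ Icc a b, d t ≤ C)
    (hle : ∀ t ∈ Icc a b, d t ≤ K * ∫ τ in a..t, d τ) :
    ∀ t ∈ Icc a b, d t = 0 := by
  intro t₀ ht₀
  have hab : a ≤ b := ht₀.1.trans ht₀.2
  -- With the weight `exp (-2Kt)`, the operator `d ↦ K ∫ d` contracts the sup norm by a factor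
  -- `1/2`, so the weighted supremum `S` satisfies `S ≤ S / 2`.
  set e : ℝ → ℝ := fun t => d t * Real.exp (-(2 * K * t)) with he
  have hexp : ∀ t, e t * Real.exp (2 * K * t) = d t := fun t => by
    rw [he]; dsimp only
    rw [mul_assoc, ← Real.exp_add]; simp
  have hbdd : BddAbove (e '' Icc a b) := by
    refine ⟨C * Real.exp (-(2 * K * a)), ?_⟩
    rintro _ ⟨t, ht, rfl⟩
    have := ht.1
    have hC0 : 0 ≤ C := (hnn t ht).trans (hC t ht)
    exact mul_le_mul (hC t ht) (Real.exp_le_exp.2 (by nlinarith)) (Real.exp_pos _).le hC0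
  set S := sSup (e '' Icc a b) with hS
  have heS : ∀ t ∈ Icc a b, e t ≤ S := fun t ht => le_csSup hbdd (mem_image_of_mem _ ht)
  have hS0 : 0 ≤ S := (mul_nonneg (hnn t₀ ht₀) (Real.exp_pos _).le).trans (heS t₀ ht₀)
  have hkey : ∀ t ∈ Icc a b, e t ≤ S / 2 := by
    intro t ht
    have h1 : ∫ τ in a..t, d τ ≤ ∫ τ in a..t, S * Real.exp (2 * K * τ) := by
      refine intervalIntegral.integral_mono_on ht.1
        (hint.mono_set (by rw [uIcc_of_le ht.1, uIcc_of_le hab]; exact Icc_subset_Icc_right ht.2))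
        (Continuous.intervalIntegrable (by fun_prop) _ _) ?_
      intro τ hτ
      rw [← hexp τ]
      exact mul_le_mul_of_nonneg_right (heS τ ⟨hτ.1, hτ.2.trans ht.2⟩) (Real.exp_pos _).le
    have h2 : ∫ τ in a..t, S * Real.exp (2 * K * τ)
        = S / (2 * K) * Real.exp (2 * K * t) - S / (2 * K) * Real.exp (2 * K * a) := by
      refine intervalIntegral.integral_eq_sub_of_hasDerivAt
        (f := fun τ => S / (2 * K) * Real.exp (2 * K * τ)) (fun τ _ => ?_)
        (Continuous.intervalIntegrable (by fun_prop) _ _)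
      refine ((((hasDerivAt_id' τ).const_mul (2 * K)).exp).const_mul (S / (2 * K))).congr_deriv ?_
      field_simp
    have h3 : d t ≤ S / 2 * Real.exp (2 * K * t) := by
      have h4 : 0 ≤ S / (2 * K) * Real.exp (2 * K * a) := by positivity
      calc d t ≤ K * ∫ τ in a..t, d τ := hle t ht
        _ ≤ K * (S / (2 * K) * Real.exp (2 * K * t)) :=
            mul_le_mul_of_nonneg_left (by linarith) hK.le
        _ = S / 2 * Real.exp (2 * K * t) := by field_simp
    rw [← hexp t] at h3
    exact le_of_mul_le_mul_right h3 (Real.exp_pos _)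
  have hS2 : S ≤ S / 2 := csSup_le ((nonempty_Icc.2 hab).image _) (by
    rintro _ ⟨t, ht, rfl⟩
    exact hkey t ht)
  have h5 : e t₀ ≤ 0 := (heS t₀ ht₀).trans (by linarith)
  refine le_antisymm ?_ (hnn t₀ ht₀)
  rw [← hexp t₀]
  exact mul_nonpos_of_nonpos_of_nonneg h5 (Real.exp_pos _).le

/-- A Grönwall lemma for functions that are only one-sidedly Lipschitz. -/
theorem eq_zero_of_ae_deriv_le {d : ℝ → ℝ} {a b K L : ℝ} (hK : 0 < K)
    (hnn : ∀ t ∈ Icc a b, 0 ≤ d t) (ha : d a = 0)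
    (hL : ∀ s ∈ Icc a b, ∀ t ∈ Icc a b, s ≤ t → d t - d s ≤ L * (t - s))
    (hd : ∀ᵐ t ∂(volume.restrict (Icc a b)), ∀ v, HasDerivAt d v t → v ≤ K * d t) :
    ∀ t ∈ Icc a b, d t = 0 := by
  rcases lt_or_ge b a with hab | hab
  · intro t ht
    exact absurd (ht.1.trans ht.2) (not_le.2 hab)
  -- The one-sided bound says exactly that `h` is monotone, hence differentiable almost everywhere.
  set h : ℝ → ℝ := fun t => L * t - d t with hh
  have hmono : MonotoneOn h (Icc a b) := by
    intro s hs t ht hst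
    have := hL s hs t ht hst
    simp only [hh]
    linarith
  have hdh : ∀ t, d t = L * t - h t := fun t => by simp [hh]
  have hint : IntervalIntegrable d volume a b := by
    have h1 : IntervalIntegrable h volume a b :=
      MonotoneOn.intervalIntegrable (by rwa [uIcc_of_le hab])
    have h2 : IntervalIntegrable (fun t : ℝ => L * t) volume a b :=
      Continuous.intervalIntegrable (by fun_prop) _ _
    exact (h2.sub h1).congr fun t _ => (hdh t).symm
  have hder : ∀ᵐ t ∂(volume.restrict (Icc a b)), L - K * d t ≤ deriv h t := by
    have h1 := hmono.ae_differentiableWithinAt measurableSet_Icc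
    filter_upwards [h1, hd, ae_restrict_Icc_mem_Ioo a b] with t h1 h2 h3
    have h4 : HasDerivAt h (deriv h t) t :=
      (h1.differentiableAt (Icc_mem_nhds h3.1 h3.2)).hasDerivAt
    have h5 : HasDerivAt d (L - deriv h t) t := by
      have := ((hasDerivAt_id t).const_mul L).sub h4
      refine (this.congr_deriv (by simp)).congr_of_eventuallyEq (Filter.Eventually.of_forall ?_)
      intro τ
      simp [hh]
    have := h2 _ h5
    linarith
  refine eq_zero_of_le_mul_intervalIntegral (C := |L| * (b - a)) hK hint hnn ?_ ?_
  · intro t ht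
    have := hL a (left_mem_Icc.2 hab) t ht ht.1
    rw [ha, sub_zero] at this
    refine this.trans (mul_le_mul (le_abs_self L) (by linarith [ht.2]) (by linarith [ht.1])
      (abs_nonneg L))
  · intro t ht
    have hsub : Icc a t ⊆ Icc a b := Icc_subset_Icc_right ht.2
    have hint' : IntervalIntegrable d volume a t :=
      hint.mono_set (by rwa [uIcc_of_le ht.1, uIcc_of_le hab])
    -- Only an inequality holds, as `h` may have a singular part; this can only make `d` smaller, so
    -- the inequality has the needed direction.
    have h1 := intervalIntegral_deriv_le_of_monotoneOn ht.1 (hmono.mono hsub)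
    have h2 : ∫ τ in a..t, (L - K * d τ) ≤ ∫ τ in a..t, deriv h τ := by
      refine intervalIntegral.integral_mono_ae_restrict ht.1
        (IntervalIntegrable.sub (by simp) (hint'.const_mul K))
        (MonotoneOn.intervalIntegrable_deriv (by
          rw [uIcc_of_le ht.1]; exact hmono.mono hsub)) ?_
      exact ae_restrict_of_ae_restrict_of_subset hsub hder
    rw [intervalIntegral.integral_sub (by simp) (hint'.const_mul K),
      intervalIntegral.integral_const, intervalIntegral.integral_const_mul, smul_eq_mul] at h2
    have h3 : h t - h a = L * t - d t - L * a := by simp [hh, ha]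
    linarith

/-- A function that is locally Lipschitz in its first argument, locally uniformly in the second,
is uniformly Lipschitz on compact sets. -/
theorem exists_lipschitz_bound_of_isCompact {E P F : Type*} [NormedAddCommGroup E]
    [TopologicalSpace P] [NormedAddCommGroup F] {f : E → P → F}
    (hf : Continuous fun p : E × P => f p.1 p.2)
    (hloc : ∀ (x₀ : E) (w₀ : P), ∃ K : NNReal, ∃ A ∈ nhds x₀, ∃ B ∈ nhds w₀,
      ∀ w ∈ B, LipschitzOnWith K (fun x => f x w) A)
    {B : Set E} {W : Set P} (hB : IsCompact B) (hW : IsCompact W) :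
    ∃ K : ℝ, 0 ≤ K ∧ ∀ x ∈ B, ∀ y ∈ B, ∀ w ∈ W, ‖f x w - f y w‖ ≤ K * ‖x - y‖ := by
  have key : ∃ K : ℝ, 0 ≤ K ∧ ∀ p ∈ B ×ˢ B ×ˢ W,
      ‖f p.1 p.2.2 - f p.2.1 p.2.2‖ ≤ K * ‖p.1 - p.2.1‖ := by
    refine (hB.prod (hB.prod hW)).induction_on (p := fun s => ∃ K : ℝ, 0 ≤ K ∧ ∀ p ∈ s,
      ‖f p.1 p.2.2 - f p.2.1 p.2.2‖ ≤ K * ‖p.1 - p.2.1‖) ⟨0, le_rfl, by simp⟩ ?_ ?_ ?_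
    · rintro s t hst ⟨K, hK, h⟩
      exact ⟨K, hK, fun p hp => h p (hst hp)⟩
    · rintro s t ⟨K, hK, h⟩ ⟨K', hK', h'⟩
      refine ⟨max K K', hK.trans (le_max_left _ _), ?_⟩
      rintro p (hp | hp)
      · exact (h p hp).trans (mul_le_mul_of_nonneg_right (le_max_left _ _) (norm_nonneg _))
      · exact (h' p hp).trans (mul_le_mul_of_nonneg_right (le_max_right _ _) (norm_nonneg _))
    · rintro ⟨x₀, y₀, w₀⟩ -
      -- On the diagonal the local Lipschitz hypothesis applies; off the diagonal the difference
      -- quotient is continuous, hence locally bounded.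
      by_cases hxy : x₀ = y₀
      · subst hxy
        obtain ⟨K, A, hA, D, hD, h⟩ := hloc x₀ w₀
        refine ⟨A ×ˢ A ×ˢ D, mem_nhdsWithin_of_mem_nhds
          (prod_mem_nhds hA (prod_mem_nhds hA hD)), K, K.2, ?_⟩
        rintro ⟨x, y, w⟩ ⟨hx, hy, hw⟩
        have := (h w hw).dist_le_mul x hx y hy
        simpa only [dist_eq_norm] using this
      · set r : E × E × P → ℝ := fun p => ‖f p.1 p.2.2 - f p.2.1 p.2.2‖ / ‖p.1 - p.2.1‖ with hr
        have hne : ‖x₀ - y₀‖ ≠ 0 := norm_ne_zero_iff.2 (sub_ne_zero.2 hxy)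
        have h1 : Continuous fun p : E × E × P => f p.1 p.2.2 :=
          hf.comp (continuous_fst.prodMk (continuous_snd.comp continuous_snd))
        have h2 : Continuous fun p : E × E × P => f p.2.1 p.2.2 := hf.comp continuous_snd
        have h3 : Continuous fun p : E × E × P => ‖p.1 - p.2.1‖ := by fun_prop
        have hrc : ContinuousAt r (x₀, y₀, w₀) :=
          ((h1.sub h2).norm.continuousAt).div h3.continuousAt hne
        have hev := (hrc.eventually (gt_mem_nhds (lt_add_one (r (x₀, y₀, w₀))))).and
          (h3.continuousAt.eventually_ne hne)
        refine ⟨_, mem_nhdsWithin_of_mem_nhds hev, r (x₀, y₀, w₀) + 1, by positivity, ?_⟩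
        rintro p ⟨hp1, hp2⟩
        have hpos : 0 < ‖p.1 - p.2.1‖ := lt_of_le_of_ne (norm_nonneg _) (Ne.symm hp2)
        exact (div_le_iff₀ hpos).1 hp1.le
  obtain ⟨K, hK, h⟩ := key
  exact ⟨K, hK, fun x hx y hy w hw => h (x, y, w) ⟨hx, hy, hw⟩⟩

theorem absolutelyContinuousOnInterval_lipschitzWith_comp {X Z : Type*} [PseudoMetricSpace X]
    [PseudoMetricSpace Z] {φ : X → Z} {K : NNReal} (hφ : LipschitzWith K φ) {x : ℝ → X} {a b : ℝ}
    (hx : AbsolutelyContinuousOnInterval x a b) :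
    AbsolutelyContinuousOnInterval (fun t => φ (x t)) a b := by
  have h0 : Filter.Tendsto (fun E : ℕ × (ℕ → ℝ × ℝ) => (K : ℝ) *
      ∑ i ∈ Finset.range E.1, dist (x (E.2 i).1) (x (E.2 i).2))
      (AbsolutelyContinuousOnInterval.totalLengthFilter ⊓
        Filter.principal (AbsolutelyContinuousOnInterval.disjWithin a b)) (nhds 0) := by
    simpa using Filter.Tendsto.const_mul (K : ℝ) hx
  refine squeeze_zero (fun E => Finset.sum_nonneg fun i _ => dist_nonneg) (fun E => ?_) h0
  rw [Finset.mul_sum]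
  exact Finset.sum_le_sum fun i _ => hφ.dist_le_mul _ _

/-! ### Support functions and metric projections. -/

section SupportFn

variable {n : ℕ} {Z : Set (Eu n)} {c : Eu n}

theorem bddAbove_inner_image (hZ : IsCompact Z) (c : Eu n) :
    BddAbove ((fun z : Eu n => inner ℝ c z) '' Z) :=
  (hZ.image (by fun_prop)).bddAbove

theorem inner_le_supportFn (hZ : IsCompact Z) {z : Eu n} (hz : z ∈ Z) :
    inner ℝ c z ≤ supportFn Z c :=
  le_csSup (bddAbove_inner_image hZ c) (mem_image_of_mem _ hz)

theorem supportFn_le (hne : Z.Nonempty) {r : ℝ} (h : ∀ z ∈ Z, inner ℝ c z ≤ r) :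
    supportFn Z c ≤ r := by
  refine csSup_le (hne.image _) ?_
  rintro _ ⟨z, hz, rfl⟩
  exact h z hz

theorem exists_inner_eq_supportFn (hZ : IsCompact Z) (hne : Z.Nonempty) (c : Eu n) :
    ∃ z ∈ Z, inner ℝ c z = supportFn Z c := by
  obtain ⟨z, hz, h⟩ := (hZ.image (f := fun z : Eu n => inner ℝ c z) (by fun_prop)).sSup_mem
    (hne.image _)
  exact ⟨z, hz, h⟩

theorem lipschitzWith_supportFn (hZ : IsCompact Z) (hne : Z.Nonempty) {R : NNReal}
    (hR : ∀ z ∈ Z, ‖z‖ ≤ R) : LipschitzWith R (supportFn Z) := by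
  refine LipschitzWith.of_le_add_mul R fun c c' => ?_
  refine supportFn_le hne fun z hz => ?_
  have h1 : inner ℝ c z = inner ℝ c' z + inner ℝ (c - c') z := by
    rw [inner_sub_left]; ring
  have h2 : inner ℝ (c - c') z ≤ R * dist c c' := by
    rw [dist_eq_norm, mul_comm]
    exact (real_inner_le_norm _ _).trans (mul_le_mul_of_nonneg_left (hR z hz) (norm_nonneg _))
  linarith [inner_le_supportFn (c := c') hZ hz]

/-- `q` is the metric projection of `x` onto the convex set `Z`, expressed by the variational
inequality. -/
def IsProj (Z : Set (Eu n)) (x q : Eu n) : Prop :=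
  q ∈ Z ∧ ∀ y ∈ Z, inner ℝ (x - q) (y - q) ≤ 0

theorem exists_isProj (hZ : IsCompact Z) (hne : Z.Nonempty) (hconv : Convex ℝ Z) (x : Eu n) :
    ∃ q, IsProj Z x q := by
  obtain ⟨q, hq, h⟩ := exists_norm_eq_iInf_of_complete_convex hne hZ.isComplete hconv x
  exact ⟨q, hq, (norm_eq_iInf_iff_real_inner_le_zero hconv hq).1 h⟩

theorem IsProj.supportFn_eq {x q : Eu n} (h : IsProj Z x q) (hZ : IsCompact Z) :
    supportFn Z (x - q) = inner ℝ (x - q) q := by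
  refine le_antisymm (supportFn_le ⟨q, h.1⟩ fun y hy => ?_) (inner_le_supportFn hZ h.1)
  have := h.2 y hy
  rw [inner_sub_right] at this
  linarith

theorem IsProj.unique {x q q' : Eu n} (h : IsProj Z x q) (h' : IsProj Z x q') : q = q' := by
  have h1 := h.2 q' h'.1
  have h2 := h'.2 q h.1
  have h3 : inner ℝ (q' - q) (q' - q) = inner ℝ (x - q) (q' - q) + inner ℝ (x - q') (q - q') := by
    simp only [inner_sub_left, inner_sub_right]; ring
  have h4 : inner ℝ (q' - q) (q' - q) ≤ 0 := by linarith
  exact (sub_eq_zero.1 ((inner_self_eq_zero (𝕜 := ℝ)).1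
    (le_antisymm h4 real_inner_self_nonneg))).symm

/-- Separation: a point outside `Z` violates the inequality in the direction from its projection to
itself. -/
theorem mem_iff_forall_inner_le (hZ : IsCompact Z) (hne : Z.Nonempty) (hconv : Convex ℝ Z)
    {q : Eu n} : q ∈ Z ↔ ∀ c : Eu n, inner ℝ c q ≤ supportFn Z c := by
  refine ⟨fun hq c => inner_le_supportFn hZ hq, fun h => ?_⟩
  obtain ⟨p, hp⟩ := exists_isProj hZ hne hconv q
  have h1 := h (q - p)
  rw [hp.supportFn_eq hZ] at h1
  have h2 : inner ℝ (q - p) (q - p) ≤ 0 := by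
    rw [inner_sub_right]; linarith
  rw [sub_eq_zero.1 ((inner_self_eq_zero (𝕜 := ℝ)).1 (le_antisymm h2 real_inner_self_nonneg))]
  exact hp.1

/-- In this form the projection is described by the support function, so closedness in `(t, x, q)`
follows from continuity of the support function. -/
theorem isProj_iff (hZ : IsCompact Z) {x q : Eu n} :
    IsProj Z x q ↔ q ∈ Z ∧ supportFn Z (x - q) ≤ inner ℝ (x - q) q := by
  refine ⟨fun h => ⟨h.1, (h.supportFn_eq hZ).le⟩, fun h => ⟨h.1, fun y hy => ?_⟩⟩
  have := inner_le_supportFn (c := x - q) hZ hy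
  rw [inner_sub_right]
  linarith [h.2]

end SupportFn

/-! ### Worst-case velocities on a supporting face. -/

section Gam

variable {nx nu nw : ℕ} {f : Eu nx → Eu nw → Eu nx} {G : Eu nx → (Eu nu →L[ℝ] Eu nx)}
  {U : Set (Eu nu)} {W : Set (Eu nw)}

theorem continuous_rhs (hf : Continuous (fun p : Eu nx × Eu nw => f p.1 p.2)) (hG : Continuous G) :
    Continuous fun p : Eu nx × Eu nu × Eu nw => rhs f G p.1 p.2.1 p.2.2 := by
  unfold rhs
  have h1 : Continuous fun p : Eu nx × Eu nu × Eu nw => f p.1 p.2.2 :=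
    hf.comp (continuous_fst.prodMk (continuous_snd.comp continuous_snd))
  exact h1.add ((hG.comp continuous_fst).clm_apply (continuous_fst.comp continuous_snd))

theorem gam_eq_image (ν : Eu nu) (c : Eu nx) (Z : Set (Eu nx)) :
    Gam f G W ν c Z = (fun p : Eu nx × Eu nw => rhs f G p.1 ν p.2) ''
      ((Z ∩ {ξ | inner ℝ c ξ = supportFn Z c}) ×ˢ W) := by
  ext y
  constructor
  · rintro ⟨ξ, ω, h1, h2, h3, rfl⟩
    exact ⟨(ξ, ω), ⟨⟨h2, h1⟩, h3⟩, rfl⟩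
  · rintro ⟨⟨ξ, ω⟩, ⟨⟨h2, h1⟩, h3⟩, rfl⟩
    exact ⟨ξ, ω, h1, h2, h3, rfl⟩

theorem isCompact_gam (hf : Continuous (fun p : Eu nx × Eu nw => f p.1 p.2)) (hG : Continuous G)
    (hW : IsCompact W) {Z : Set (Eu nx)} (hZ : IsCompact Z) (ν : Eu nu) (c : Eu nx) :
    IsCompact (Gam f G W ν c Z) := by
  rw [gam_eq_image]
  refine IsCompact.image ((hZ.inter_right (isClosed_eq (by fun_prop) continuous_const)).prod hW) ?_
  exact (continuous_rhs hf hG).comp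
    (continuous_fst.prodMk (continuous_const.prodMk continuous_snd))

theorem gam_nonempty (hW : W.Nonempty) {Z : Set (Eu nx)} (hZ : IsCompact Z) (hne : Z.Nonempty)
    (ν : Eu nu) (c : Eu nx) : (Gam f G W ν c Z).Nonempty := by
  obtain ⟨ξ, hξ, h⟩ := exists_inner_eq_supportFn hZ hne c
  obtain ⟨ω, hω⟩ := hW
  exact ⟨_, ξ, ω, h, hξ, hω, rfl⟩

theorem le_supportFn_gam_iff (hf : Continuous (fun p : Eu nx × Eu nw => f p.1 p.2))
    (hG : Continuous G) (hW : IsCompact W) (hWne : W.Nonempty) {Z : Set (Eu nx)} (hZ : IsCompact Z)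
    (hne : Z.Nonempty) {ν : Eu nu} {c : Eu nx} {r : ℝ} :
    r ≤ supportFn (Gam f G W ν c Z) c ↔
      ∃ ξ ∈ Z, ∃ ω ∈ W, supportFn Z c ≤ inner ℝ c ξ ∧ r ≤ inner ℝ c (rhs f G ξ ν ω) := by
  constructor
  · intro h
    obtain ⟨y, ⟨ξ, ω, h1, h2, h3, rfl⟩, hy⟩ := exists_inner_eq_supportFn
      (isCompact_gam hf hG hW hZ ν c) (gam_nonempty hWne hZ hne ν c) c
    exact ⟨ξ, h2, ω, h3, h1.ge, h.trans hy.ge⟩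
  · rintro ⟨ξ, h2, ω, h3, h1, hr⟩
    exact hr.trans (inner_le_supportFn (isCompact_gam hf hG hW hZ ν c)
      ⟨ξ, ω, le_antisymm (inner_le_supportFn hZ h2) h1, h2, h3, rfl⟩)

theorem neg_mul_le_supportFn_gam (hf : Continuous (fun p : Eu nx × Eu nw => f p.1 p.2))
    (hG : Continuous G) (hW : IsCompact W) (hWne : W.Nonempty) {Z : Set (Eu nx)} (hZ : IsCompact Z)
    (hne : Z.Nonempty) {M : ℝ} {ν : Eu nu} (hM : ∀ ξ ∈ Z, ∀ ω ∈ W, ‖rhs f G ξ ν ω‖ ≤ M)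
    (c : Eu nx) : -(M * ‖c‖) ≤ supportFn (Gam f G W ν c Z) c := by
  rw [le_supportFn_gam_iff hf hG hW hWne hZ hne]
  obtain ⟨ξ, hξ, h⟩ := exists_inner_eq_supportFn hZ hne c
  obtain ⟨ω, hω⟩ := hWne
  refine ⟨ξ, hξ, ω, hω, h.ge, ?_⟩
  have h1 := abs_le.1 (abs_real_inner_le_norm c (rhs f G ξ ν ω))
  have h2 := mul_le_mul_of_nonneg_left (hM ξ hξ ω hω) (norm_nonneg c)
  linarith [h1.1, mul_comm M ‖c‖]

theorem neg_mul_le_minMax (hf : Continuous (fun p : Eu nx × Eu nw => f p.1 p.2))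
    (hG : Continuous G) (hU : U.Nonempty) (hW : IsCompact W) (hWne : W.Nonempty) {Z : Set (Eu nx)}
    (hZ : IsCompact Z) (hne : Z.Nonempty) {M : ℝ}
    (hM : ∀ ξ ∈ Z, ∀ ν ∈ U, ∀ ω ∈ W, ‖rhs f G ξ ν ω‖ ≤ M) (c : Eu nx) :
    -(M * ‖c‖) ≤ minMax f G U W c Z := by
  refine le_csInf (hU.image _) ?_
  rintro _ ⟨ν, hν, rfl⟩
  exact neg_mul_le_supportFn_gam hf hG hW hWne hZ hne (fun ξ hξ ω hω => hM ξ hξ ν hν ω hω) c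

theorem exists_rhs_bound (hf : Continuous (fun p : Eu nx × Eu nw => f p.1 p.2)) (hG : Continuous G)
    (hU : IsCompact U) (hW : IsCompact W) {B : Set (Eu nx)} (hB : IsCompact B) :
    ∃ M : ℝ, ∀ ξ ∈ B, ∀ ν ∈ U, ∀ ω ∈ W, ‖rhs f G ξ ν ω‖ ≤ M := by
  obtain ⟨M, hM⟩ := (hB.prod (hU.prod hW)).exists_bound_of_continuousOn
    (continuous_rhs hf hG).continuousOn
  exact ⟨M, fun ξ hξ ν hν ω hω => hM (ξ, ν, ω) ⟨hξ, hν, hω⟩⟩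

theorem exists_rhs_lipschitz (hf : Continuous (fun p : Eu nx × Eu nw => f p.1 p.2))
    (hfLip : LocLipschitzInState f) (hG : ContDiff ℝ 1 G) (hU : IsCompact U) (hW : IsCompact W)
    {B : Set (Eu nx)} (hB : IsCompact B) :
    ∃ K : ℝ, 0 ≤ K ∧ ∀ x ∈ B, ∀ y ∈ B, ∀ ν ∈ U, ∀ ω ∈ W,
      ‖rhs f G x ν ω - rhs f G y ν ω‖ ≤ K * ‖x - y‖ := by
  obtain ⟨K, hK, h⟩ := exists_lipschitz_bound_of_isCompact hf hfLip hB hW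
  -- A one-point parameter space reduces `G` to the same compactness lemma.
  obtain ⟨K', hK', h'⟩ := exists_lipschitz_bound_of_isCompact (f := fun x (_ : Unit) => G x)
    (hG.continuous.comp continuous_fst) (fun x₀ _ => by
      obtain ⟨K, A, hA, hL⟩ := hG.locallyLipschitz x₀
      exact ⟨K, A, hA, univ, Filter.univ_mem, fun _ _ => hL⟩) hB (isCompact_singleton (x := ()))
  obtain ⟨C, hC⟩ := hU.exists_bound_of_continuousOn (f := fun u : Eu nu => u) continuousOn_id
  refine ⟨K + K' * |C|, by positivity, fun x hx y hy ν hν ω hω => ?_⟩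
  have e : rhs f G x ν ω - rhs f G y ν ω = (f x ω - f y ω) + (G x - G y) ν := by
    simp only [rhs, sub_apply]; abel
  have h1 : ‖(G x - G y) ν‖ ≤ (K' * ‖x - y‖) * |C| :=
    ((G x - G y).le_opNorm ν).trans (mul_le_mul (h' x hx y hy () rfl)
      ((hC ν hν).trans (le_abs_self C)) (norm_nonneg _) (by positivity))
  rw [e]
  refine (norm_add_le _ _).trans ((add_le_add (h x hx y hy ω hω) h1).trans (le_of_eq ?_))
  ring

end Gam

/-! ### Continuity of the tube and of its projection map. -/

/-- The projection of a closed set along a compact factor is closed. -/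
theorem isClosed_setOf_exists_mem_of_isCompact {X P : Type*} [TopologicalSpace X]
    [TopologicalSpace P] {Q : Set P} (hQ : IsCompact Q) {S : Set (X × P)} (hS : IsClosed S) :
    IsClosed {x | ∃ p ∈ Q, (x, p) ∈ S} := by
  have : CompactSpace Q := isCompact_iff_compactSpace.1 hQ
  have h := isClosedMap_fst_of_compactSpace (X := X) (Y := Q) _
    (hS.preimage (f := fun z : X × Q => (z.1, (z.2 : P))) (by fun_prop))
  convert h using 1
  ext x
  constructor
  · rintro ⟨p, hp, hx⟩
    exact ⟨(x, ⟨p, hp⟩), hx, rfl⟩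
  · rintro ⟨⟨x', p⟩, hx, rfl⟩
    exact ⟨p, p.2, hx⟩

section Tube

variable {n : ℕ} {Y : ℝ → Set (Eu n)} {R : NNReal}

theorem continuous_supportFn_uncurry (hY : ∀ t, (Y t).Nonempty ∧ IsCompact (Y t) ∧ Convex ℝ (Y t))
    (hV : ∀ c, Continuous fun t => supportFn (Y t) c) (hR : ∀ t, ∀ z ∈ Y t, ‖z‖ ≤ R) :
    Continuous fun p : ℝ × Eu n => supportFn (Y p.1) p.2 :=
  continuous_prod_of_continuous_lipschitzWith' _ R
    (fun t => lipschitzWith_supportFn (hY t).2.1 (hY t).1 (hR t)) hV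

theorem isClosed_setOf_mem_tube (hY : ∀ t, (Y t).Nonempty ∧ IsCompact (Y t) ∧ Convex ℝ (Y t))
    (hV : ∀ c, Continuous fun t => supportFn (Y t) c) :
    IsClosed {p : ℝ × Eu n | p.2 ∈ Y p.1} := by
  have : {p : ℝ × Eu n | p.2 ∈ Y p.1} =
      ⋂ c : Eu n, {p | inner ℝ c p.2 ≤ supportFn (Y p.1) c} := by
    ext p
    simp only [mem_ofPred_eq, mem_iInter]
    exact mem_iff_forall_inner_le (hY p.1).2.1 (hY p.1).1 (hY p.1).2.2
  rw [this]
  exact isClosed_iInter fun c => isClosed_le (by fun_prop) ((hV c).comp continuous_fst)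

/-- Closed graph argument: the projections stay in a fixed compact ball and are unique, so the
preimage of a closed set is the shadow of a closed set along a compact factor. -/
theorem continuous_proj (hY : ∀ t, (Y t).Nonempty ∧ IsCompact (Y t) ∧ Convex ℝ (Y t))
    (hV : ∀ c, Continuous fun t => supportFn (Y t) c) (hR : ∀ t, ∀ z ∈ Y t, ‖z‖ ≤ R)
    {q : ℝ → Eu n → Eu n} (hq : ∀ t x, IsProj (Y t) x (q t x)) :
    Continuous fun p : ℝ × Eu n => q p.1 p.2 := by
  rw [continuous_iff_isClosed]
  intro C hC
  have hS : IsClosed {z : (ℝ × Eu n) × Eu n | z.2 ∈ C ∧ z.2 ∈ Y z.1.1 ∧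
      supportFn (Y z.1.1) (z.1.2 - z.2) ≤ inner ℝ (z.1.2 - z.2) z.2} := by
    refine (hC.preimage continuous_snd).inter (IsClosed.inter ?_ ?_)
    · exact (isClosed_setOf_mem_tube hY hV).preimage
        (f := fun z : (ℝ × Eu n) × Eu n => (z.1.1, z.2)) (by fun_prop)
    · exact isClosed_le ((continuous_supportFn_uncurry hY hV hR).comp
        (f := fun z : (ℝ × Eu n) × Eu n => (z.1.1, z.1.2 - z.2)) (by fun_prop)) (by fun_prop)
  convert isClosed_setOf_exists_mem_of_isCompact
    (isCompact_closedBall (0 : Eu n) R) hS using 1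
  ext ⟨t, x⟩
  constructor
  · intro h
    exact ⟨q t x, by simpa using hR t _ (hq t x).1, h, (isProj_iff (hY t).2.1).1 (hq t x)⟩
  · rintro ⟨p, -, hpC, hp⟩
    have := (hq t x).unique ((isProj_iff (hY t).2.1).2 hp)
    simpa only [mem_preimage, this] using hpC

end Tube

/-! ### Measurable selection of the feedback. -/

section Selection

variable {nx nu nw : ℕ} {f : Eu nx → Eu nw → Eu nx} {G : Eu nx → (Eu nu →L[ℝ] Eu nx)}
  {U : Set (Eu nu)} {W : Set (Eu nw)} {Y : ℝ → Set (Eu nx)} {R : NNReal}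

/-- The function is upper semicontinuous: each superlevel set is the shadow, along the compact
factor of pairs `(ξ, ω)`, of a closed set. -/
theorem measurable_supportFn_gam (hf : Continuous (fun p : Eu nx × Eu nw => f p.1 p.2))
    (hG : Continuous G) (hW : IsCompact W) (hWne : W.Nonempty)
    (hY : ∀ t, (Y t).Nonempty ∧ IsCompact (Y t) ∧ Convex ℝ (Y t))
    (hV : ∀ c, Continuous fun t => supportFn (Y t) c) (hR : ∀ t, ∀ z ∈ Y t, ‖z‖ ≤ R)
    {q : ℝ → Eu nx → Eu nx} (hq : Continuous fun p : ℝ × Eu nx => q p.1 p.2) (ν : Eu nu) :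
    Measurable fun p : ℝ × Eu nx =>
      supportFn (Gam f G W ν (p.2 - q p.1 p.2) (Y p.1)) (p.2 - q p.1 p.2) := by
  refine measurable_of_Ici fun r => IsClosed.measurableSet ?_
  have hc : Continuous fun z : (ℝ × Eu nx) × (Eu nx × Eu nw) => z.1.2 - q z.1.1 z.1.2 :=
    (continuous_snd.comp continuous_fst).sub (hq.comp continuous_fst)
  have hS : IsClosed {z : (ℝ × Eu nx) × (Eu nx × Eu nw) | z.2.1 ∈ Y z.1.1 ∧
      supportFn (Y z.1.1) (z.1.2 - q z.1.1 z.1.2) ≤ inner ℝ (z.1.2 - q z.1.1 z.1.2) z.2.1 ∧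
      r ≤ inner ℝ (z.1.2 - q z.1.1 z.1.2) (rhs f G z.2.1 ν z.2.2)} := by
    refine IsClosed.inter ?_ (IsClosed.inter ?_ ?_)
    · exact (isClosed_setOf_mem_tube hY hV).preimage
        (f := fun z : (ℝ × Eu nx) × (Eu nx × Eu nw) => (z.1.1, z.2.1)) (by fun_prop)
    · exact isClosed_le ((continuous_supportFn_uncurry hY hV hR).comp
        ((continuous_fst.comp continuous_fst).prodMk hc))
        (hc.inner (𝕜 := ℝ) (continuous_fst.comp continuous_snd))
    · refine isClosed_le continuous_const (hc.inner (𝕜 := ℝ) ?_)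
      exact (continuous_rhs hf hG).comp
        (f := fun z : (ℝ × Eu nx) × (Eu nx × Eu nw) => (z.2.1, ν, z.2.2)) (by fun_prop)
  convert isClosed_setOf_exists_mem_of_isCompact
    ((isCompact_closedBall (0 : Eu nx) R).prod hW) hS using 1
  ext ⟨t, x⟩
  simp only [mem_preimage, mem_Ici, mem_ofPred_eq]
  rw [le_supportFn_gam_iff hf hG hW hWne (hY t).2.1 (hY t).1]
  constructor
  · rintro ⟨ξ, hξ, ω, hω, h1, h2⟩
    exact ⟨(ξ, ω), ⟨by simpa using hR t ξ hξ, hω⟩, hξ, h1, h2⟩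
  · rintro ⟨⟨ξ, ω⟩, ⟨-, hω⟩, hξ, h1, h2⟩
    exact ⟨ξ, hξ, ω, hω, h1, h2⟩

/-- The supporting face does not depend on `ν`, so maximizers `(ξ, ω)` for a nearby `u k` are
admissible for `ν`, and the values differ by at most `‖c‖ ‖G ξ‖ ‖u k - ν‖`. Hence countably many
controls suffice. -/
theorem iInf_supportFn_gam_le_minMax (hf : Continuous (fun p : Eu nx × Eu nw => f p.1 p.2))
    (hG : Continuous G) (hU : IsCompact U) (hW : IsCompact W) (hWne : W.Nonempty)
    {u : ℕ → U} (hu : DenseRange u) {Z : Set (Eu nx)} (hZ : IsCompact Z)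
    (hne : Z.Nonempty) (c : Eu nx) :
    ⨅ k, supportFn (Gam f G W (u k : Eu nu) c Z) c ≤ minMax f G U W c Z := by
  obtain ⟨M, hM⟩ := exists_rhs_bound hf hG hU hW hZ
  have hbdd : BddBelow (range fun k => supportFn (Gam f G W (u k : Eu nu) c Z) c) := by
    refine ⟨-(M * ‖c‖), ?_⟩
    rintro _ ⟨k, rfl⟩
    exact neg_mul_le_supportFn_gam hf hG hW hWne hZ hne
      (fun ξ hξ ω hω => hM ξ hξ _ (u k).2 ω hω) c
  obtain ⟨C, hC⟩ := hZ.exists_bound_of_continuousOn hG.continuousOn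
  refine le_csInf (Nonempty.image _ ⟨_, (u 0).2⟩) ?_
  rintro _ ⟨ν, hν, rfl⟩
  refine le_of_forall_pos_le_add fun ε hε => ?_
  set D : ℝ := ‖c‖ * |C| + 1 with hD
  have hD0 : 0 < D := by positivity
  obtain ⟨k, hk⟩ := hu.exists_dist_lt (⟨ν, hν⟩ : U) (div_pos hε hD0)
  refine (ciInf_le hbdd k).trans ?_
  obtain ⟨ξ, hξ, ω, hω, h1, h2⟩ := (le_supportFn_gam_iff hf hG hW hWne hZ hne).1
    (le_refl (supportFn (Gam f G W (u k : Eu nu) c Z) c))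
  have h3 : inner ℝ c (rhs f G ξ ν ω) ≤ supportFn (Gam f G W ν c Z) c :=
    (le_supportFn_gam_iff hf hG hW hWne hZ hne).2 ⟨ξ, hξ, ω, hω, h1, le_rfl⟩
  have h4 : inner ℝ c (rhs f G ξ (u k) ω) =
      inner ℝ c (rhs f G ξ ν ω) + inner ℝ c (G ξ ((u k : Eu nu) - ν)) := by
    simp only [rhs, map_sub, inner_add_right, inner_sub_right]; ring
  have h5 : ‖(u k : Eu nu) - ν‖ ≤ ε / D := by
    rw [← dist_eq_norm, dist_comm]; exact hk.le
  have h6 : inner ℝ c (G ξ ((u k : Eu nu) - ν)) ≤ ε := by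
    calc inner ℝ c (G ξ ((u k : Eu nu) - ν)) ≤ ‖c‖ * ‖G ξ ((u k : Eu nu) - ν)‖ :=
          real_inner_le_norm _ _
      _ ≤ ‖c‖ * (|C| * (ε / D)) := by
          refine mul_le_mul_of_nonneg_left (((G ξ).le_opNorm _).trans ?_) (norm_nonneg c)
          exact mul_le_mul ((hC ξ hξ).trans (le_abs_self C)) h5 (norm_nonneg _) (abs_nonneg C)
      _ = (‖c‖ * |C|) * (ε / D) := by ring
      _ ≤ D * (ε / D) := mul_le_mul_of_nonneg_right (by linarith) (by positivity)
      _ = ε := by field_simp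
  linarith

/-- A Borel measurable feedback law that is a near-minimizer of the worst-case outward velocity
in the direction pointing from the tube to the state. -/
theorem exists_measurable_feedback (hf : Continuous (fun p : Eu nx × Eu nw => f p.1 p.2))
    (hG : Continuous G) (hU : IsCompact U) (hUne : U.Nonempty) (hW : IsCompact W)
    (hWne : W.Nonempty) (hY : ∀ t, (Y t).Nonempty ∧ IsCompact (Y t) ∧ Convex ℝ (Y t))
    (hV : ∀ c, Continuous fun t => supportFn (Y t) c) (hR : ∀ t, ∀ z ∈ Y t, ‖z‖ ≤ R)
    {q : ℝ → Eu nx → Eu nx} (hq : ∀ t x, IsProj (Y t) x (q t x)) :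
    ∃ μ : ℝ → Eu nx → Eu nu, Measurable (fun p : ℝ × Eu nx => μ p.1 p.2) ∧
      (∀ t x, μ t x ∈ U) ∧ ∀ t x, x ≠ q t x →
        supportFn (Gam f G W (μ t x) (x - q t x) (Y t)) (x - q t x) ≤
          minMax f G U W (x - q t x) (Y t) + ‖x - q t x‖ ^ 2 := by
  classical
  have : Nonempty U := hUne.to_subtype
  obtain ⟨u, hu⟩ := TopologicalSpace.exists_dense_seq U
  have hqc := continuous_proj hY hV hR hq
  set Φ : ℕ → ℝ × Eu nx → ℝ := fun k p =>
    supportFn (Gam f G W (u k : Eu nu) (p.2 - q p.1 p.2) (Y p.1)) (p.2 - q p.1 p.2) with hΦ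
  have hΦm : ∀ k, Measurable (Φ k) := fun k =>
    measurable_supportFn_gam hf hG hW hWne hY hV hR hqc _
  have hnm : Measurable fun p : ℝ × Eu nx => ‖p.2 - q p.1 p.2‖ ^ 2 :=
    ((continuous_snd.sub hqc).norm.pow 2).measurable
  -- The slack `‖x - q‖ ^ 2` is positive off the tube, so some index qualifies; on the tube any
  -- index is accepted. Its quadratic order costs only an extra `1` in the Grönwall rate. The least
  -- such index is a measurable choice.
  let P : ℝ × Eu nx → ℕ → Prop := fun p k =>
    p.2 = q p.1 p.2 ∨ Φ k p < (⨅ j, Φ j p) + ‖p.2 - q p.1 p.2‖ ^ 2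
  have hP : ∀ p, ∃ k, P p k := by
    intro p
    by_cases h : p.2 = q p.1 p.2
    · exact ⟨0, Or.inl h⟩
    · have h0 : 0 < ‖p.2 - q p.1 p.2‖ ^ 2 := pow_pos (norm_pos_iff.2 (sub_ne_zero.2 h)) 2
      obtain ⟨k, hk⟩ := exists_lt_of_ciInf_lt (lt_add_of_pos_right (⨅ j, Φ j p) h0)
      exact ⟨k, Or.inr hk⟩
  have hPm : ∀ k, MeasurableSet {p | P p k} := fun k =>
    (isClosed_eq continuous_snd hqc).measurableSet.union
      (measurableSet_lt (hΦm k) ((Measurable.iInf hΦm).add hnm))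
  have hfind : Measurable fun p => Nat.find (hP p) := measurable_find hP hPm
  refine ⟨fun t x => u (Nat.find (hP (t, x))), ?_, fun t x => Subtype.coe_prop _, ?_⟩
  · exact (measurable_from_nat (f := fun k => (u k : Eu nu))).comp hfind
  · intro t x hx
    have h1 := (Nat.find_spec (hP (t, x))).resolve_left hx
    exact h1.le.trans (add_le_add_left
      (iInf_supportFn_gam_le_minMax hf hG hU hW hWne hu (hY t).2.1 (hY t).1 _) _)

end Selection

/-! ### Bounds for the feedback and for the tube. -/

theorem locallyIntegrable_of_measurable_of_bound {X E : Type*} [TopologicalSpace X]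
    [MeasurableSpace X] {m : Measure X} [IsLocallyFiniteMeasure m] [NormedAddCommGroup E]
    [MeasurableSpace E] [BorelSpace E] [SecondCountableTopology E] {φ : X → E}
    (hφ : Measurable φ) {C : ℝ} (hC : ∀ p, ‖φ p‖ ≤ C) : LocallyIntegrable φ m :=
  (locallyIntegrable_const C).mono hφ.aestronglyMeasurable
    (ae_of_all _ fun p => (hC p).trans (Real.le_norm_self C))

/-- Each coordinate is controlled by the support function in the directions `±e i`, which is bounded
on the compact time interval. -/
theorem exists_tube_bound {n : ℕ} {Y : ℝ → Set (Eu n)} {t₁ t₂ : ℝ}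
    (hY : ∀ t ∈ Icc t₁ t₂, IsCompact (Y t))
    (hV : ∀ c, ContinuousOn (fun t => supportFn (Y t) c) (Icc t₁ t₂)) :
    ∃ R : NNReal, ∀ t ∈ Icc t₁ t₂, ∀ z ∈ Y t, ‖z‖ ≤ R := by
  let e := EuclideanSpace.basisFun (Fin n) ℝ
  choose C hC using fun c : Eu n =>
    isCompact_Icc.exists_bound_of_continuousOn (hV c)
  refine ⟨(∑ i, max (C (e i)) (C (-(e i)))).toNNReal, fun t ht z hz => ?_⟩
  refine le_trans ?_ (Real.le_coe_toNNReal _)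
  have hz' : ∀ c, inner ℝ c z ≤ C c := fun c =>
    (inner_le_supportFn (hY t ht) hz).trans ((Real.le_norm_self _).trans (hC c t ht))
  calc ‖z‖ = ‖∑ i, inner ℝ (e i) z • e i‖ := by rw [e.sum_repr' z]
    _ ≤ ∑ i, ‖inner ℝ (e i) z • e i‖ := norm_sum_le _ _
    _ ≤ ∑ i, max (C (e i)) (C (-(e i))) := by
      refine Finset.sum_le_sum fun i _ => ?_
      rw [norm_smul, e.norm_eq_one, mul_one, Real.norm_eq_abs]
      refine abs_le'.2 ⟨(hz' _).trans (le_max_left _ _), ?_⟩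
      rw [← inner_neg_left]
      exact (hz' _).trans (le_max_right _ _)

/-! ### The distance to the tube along a closed-loop solution. -/

section Invariance

variable {nx nu nw : ℕ} {f : Eu nx → Eu nw → Eu nx} {G : Eu nx → (Eu nu →L[ℝ] Eu nx)}
  {U : Set (Eu nu)} {W : Set (Eu nw)} {Y : ℝ → Set (Eu nx)}

theorem inner_sub_supportFn_le {Z : Set (Eu nx)} (hZ : IsCompact Z) {q : Eu nx} (hq : q ∈ Z)
    (c x : Eu nx) : inner ℝ c x - supportFn Z c ≤ ‖c‖ * ‖x - q‖ := by
  have h1 := real_inner_le_norm c (x - q)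
  rw [inner_sub_right] at h1
  linarith [inner_le_supportFn (c := c) hZ hq]

theorem IsProj.inner_sub_supportFn_eq {Z : Set (Eu nx)} (hZ : IsCompact Z) {x q : Eu nx}
    (h : IsProj Z x q) : inner ℝ (x - q) x - supportFn Z (x - q) = ‖x - q‖ * ‖x - q‖ := by
  rw [h.supportFn_eq hZ, ← inner_sub_right, real_inner_self_eq_norm_mul_norm]

/-- One `M * ‖c‖` bounds the speed of the solution, the other the decrease of the support function,
whose derivative is at least the min-max value. The Lipschitz constants in `hLip` serve only for
absolute continuity, so the rate depends on `c` through `‖c‖` alone. -/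
theorem inner_sub_supportFn_increment_le
    (hf : Continuous (fun p : Eu nx × Eu nw => f p.1 p.2)) (hG : Continuous G) (hU : U.Nonempty)
    (hW : IsCompact W) {t₁ t₂ : ℝ}
    (hY : ∀ t ∈ Icc t₁ t₂, (Y t).Nonempty ∧ IsCompact (Y t) ∧ Convex ℝ (Y t))
    (hLip : ∀ c : Eu nx, ∃ K : NNReal,
      LipschitzOnWith K (fun t => supportFn (Y t) c) (Icc t₁ t₂))
    (hDI : ∀ᵐ t ∂(volume.restrict (Icc t₁ t₂)), ∀ c : Eu nx,
      ∃ v : ℝ, HasDerivAt (fun s => supportFn (Y s) c) v t ∧ v ≥ minMax f G U W c (Y t))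
    {B : Set (Eu nx)} {M : ℝ} (hM : ∀ ξ ∈ B, ∀ ν ∈ U, ∀ ω ∈ W, ‖rhs f G ξ ν ω‖ ≤ M)
    (hYB : ∀ t ∈ Icc t₁ t₂, Y t ⊆ B)
    {μ : ℝ → Eu nx → Eu nu} (hμU : ∀ t x, μ t x ∈ U) {w : ℝ → Eu nw} (hw : ∀ t, w t ∈ W)
    {x : ℝ → Eu nx} {s t : ℝ} (hs : t₁ ≤ s) (hst : s ≤ t) (ht : t ≤ t₂)
    (hxB : ∀ τ ∈ Icc s t, x τ ∈ B) (hx : IsSolution f G μ w s t x) (c : Eu nx) :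
    (inner ℝ c (x t) - supportFn (Y t) c) - (inner ℝ c (x s) - supportFn (Y s) c) ≤
      2 * M * ‖c‖ * (t - s) := by
  have hsub : Icc s t ⊆ Icc t₁ t₂ := Icc_subset_Icc hs ht
  refine sub_le_mul_of_ae_hasDerivAt_le (m := fun τ => inner ℝ c (x τ) - supportFn (Y τ) c)
    hst ?_ ?_
  · obtain ⟨K, hK⟩ := hLip c
    refine AbsolutelyContinuousOnInterval.sub
      (f := fun τ => inner ℝ c (x τ)) (g := fun τ => supportFn (Y τ) c) ?_ ?_
    · exact absolutelyContinuousOnInterval_lipschitzWith_comp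
        (φ := fun y => inner ℝ c y) (innerSL ℝ c).lipschitz hx.1
    · refine LipschitzOnWith.absolutelyContinuousOnInterval (K := K) ?_
      rw [uIcc_of_le hst]
      exact hK.mono hsub
  · filter_upwards [hx.2, ae_restrict_of_ae_restrict_of_subset hsub hDI,
      ae_restrict_mem measurableSet_Icc] with τ h1 h2 hτ
    obtain ⟨v, hv, hvm⟩ := h2 c
    have hYτ := hY τ (hsub hτ)
    refine ⟨_, ((hasDerivAt_const τ c).inner ℝ h1).sub hv, ?_⟩
    have h3 : -(M * ‖c‖) ≤ v := (neg_mul_le_minMax hf hG hU hW ⟨_, hw τ⟩ hYτ.2.1 hYτ.1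
      (fun ξ hξ => hM ξ (hYB τ (hsub hτ) hξ)) c).trans hvm
    have h4 := (real_inner_le_norm c (rhs f G (x τ) (μ τ (x τ)) (w τ))).trans
      (mul_le_mul_of_nonneg_left (hM _ (hxB τ hτ) _ (hμU τ (x τ)) _ (hw τ)) (norm_nonneg c))
    simp only [inner_zero_left, add_zero]
    linarith

theorem mem_tube_of_isSolution
    (hf : Continuous (fun p : Eu nx × Eu nw => f p.1 p.2)) (hfLip : LocLipschitzInState f)
    (hG : ContDiff ℝ 1 G) (hU : IsCompact U) (hUne : U.Nonempty) (hW : IsCompact W) {t₁ t₂ : ℝ}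
    (hY : ∀ t ∈ Icc t₁ t₂, (Y t).Nonempty ∧ IsCompact (Y t) ∧ Convex ℝ (Y t))
    (hLip : ∀ c : Eu nx, ∃ K : NNReal,
      LipschitzOnWith K (fun t => supportFn (Y t) c) (Icc t₁ t₂))
    (hDI : ∀ᵐ t ∂(volume.restrict (Icc t₁ t₂)), ∀ c : Eu nx,
      ∃ v : ℝ, HasDerivAt (fun s => supportFn (Y s) c) v t ∧ v ≥ minMax f G U W c (Y t))
    {R : ℝ} (hR : ∀ t ∈ Icc t₁ t₂, ∀ z ∈ Y t, ‖z‖ ≤ R)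
    {q : ℝ → Eu nx → Eu nx} (hq : ∀ t ∈ Icc t₁ t₂, ∀ x, IsProj (Y t) x (q t x))
    {μ : ℝ → Eu nx → Eu nu} (hμU : ∀ t x, μ t x ∈ U)
    (hμ : ∀ t ∈ Icc t₁ t₂, ∀ x, x ≠ q t x →
      supportFn (Gam f G W (μ t x) (x - q t x) (Y t)) (x - q t x) ≤
        minMax f G U W (x - q t x) (Y t) + ‖x - q t x‖ ^ 2)
    {w : ℝ → Eu nw} (hw : ∀ t, w t ∈ W) {a b : ℝ} (ha : t₁ ≤ a) (hab : a ≤ b) (hb : b ≤ t₂)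
    {x : ℝ → Eu nx} (hx : IsSolution f G μ w a b x) (hxa : x a ∈ Y a) :
    ∀ t ∈ Icc a b, x t ∈ Y t := by
  have hsub : Icc a b ⊆ Icc t₁ t₂ := Icc_subset_Icc ha hb
  have hxc : ContinuousOn x (Icc a b) := by
    have := hx.1.continuousOn
    rwa [uIcc_of_le hab] at this
  obtain ⟨R', hR'⟩ := isCompact_Icc.exists_bound_of_continuousOn hxc
  -- One ball holding both the tube and the trajectory, since velocities are compared at `x t` and
  -- at its projection.
  set B : Set (Eu nx) := Metric.closedBall 0 (max R R') with hB
  have hBc : IsCompact B := isCompact_closedBall _ _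
  have hYB : ∀ t ∈ Icc t₁ t₂, Y t ⊆ B := fun t ht z hz => by
    simpa [hB] using Or.inl (hR t ht z hz)
  have hxB : ∀ t ∈ Icc a b, x t ∈ B := fun t ht => by
    simpa [hB] using Or.inr (hR' t ht)
  obtain ⟨M₀, hM₀⟩ := exists_rhs_bound hf hG.continuous hU hW hBc
  have hM : ∀ ξ ∈ B, ∀ ν ∈ U, ∀ ω ∈ W, ‖rhs f G ξ ν ω‖ ≤ |M₀| :=
    fun ξ hξ ν hν ω hω => (hM₀ ξ hξ ν hν ω hω).trans (le_abs_self _)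
  obtain ⟨K, hK0, hK⟩ := exists_rhs_lipschitz hf hfLip hG hU hW hBc
  set d : ℝ → ℝ := fun t => ‖x t - q t (x t)‖ with hd
  have hlow : ∀ s ∈ Icc t₁ t₂, ∀ c : Eu nx,
      inner ℝ c (x s) - supportFn (Y s) c ≤ ‖c‖ * d s := fun s hs c =>
    inner_sub_supportFn_le (hY s hs).2.1 (hq s hs (x s)).1 c (x s)
  have heq : ∀ t ∈ Icc t₁ t₂, inner ℝ (x t - q t (x t)) (x t)
      - supportFn (Y t) (x t - q t (x t)) = d t * d t := fun t ht =>
    (hq t ht (x t)).inner_sub_supportFn_eq (hY t ht).2.1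
  have hone : ∀ s ∈ Icc a b, ∀ t ∈ Icc a b, s ≤ t → d t - d s ≤ 2 * |M₀| * (t - s) := by
    intro s hs t ht hst
    rcases (norm_nonneg (x t - q t (x t))).eq_or_lt with h0 | h0
    · have h1 : 0 ≤ 2 * |M₀| * (t - s) := mul_nonneg (by positivity) (sub_nonneg.2 hst)
      have h2 : 0 ≤ d s := norm_nonneg _
      have h3 : d t = 0 := h0.symm
      linarith
    · have hsol : IsSolution f G μ w s t x :=
        ⟨hx.1.mono (by rw [uIcc_of_le hst, uIcc_of_le hab]; exact Icc_subset_Icc hs.1 ht.2),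
          ae_restrict_of_ae_restrict_of_subset (Icc_subset_Icc hs.1 ht.2) hx.2⟩
      have h1 := inner_sub_supportFn_increment_le hf hG.continuous hUne hW hY hLip hDI hM hYB hμU
        hw (ha.trans hs.1) hst (ht.2.trans hb)
        (fun τ hτ => hxB τ ⟨hs.1.trans hτ.1, hτ.2.trans ht.2⟩) hsol (x t - q t (x t))
      rw [heq t (hsub ht)] at h1
      have h2 := hlow s (hsub hs) (x t - q t (x t))
      have h3 : d t * (d t - d s) ≤ d t * (2 * |M₀| * (t - s)) := by
        have e : ‖x t - q t (x t)‖ = d t := rfl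
        rw [e] at h1 h2
        linarith
      exact le_of_mul_le_mul_left h3 h0
  have hder : ∀ᵐ t ∂(volume.restrict (Icc a b)), ∀ v, HasDerivAt d v t → v ≤ (K + 1) * d t := by
    filter_upwards [hx.2, ae_restrict_of_ae_restrict_of_subset hsub hDI,
      ae_restrict_Icc_mem_Ioo a b] with t h1 h2 ht v hv
    have htI : t ∈ Icc a b := Ioo_subset_Icc_self ht
    have htJ := hsub htI
    rcases (norm_nonneg (x t - q t (x t))).eq_or_lt with h0 | h0
    · have h3 : d t = 0 := h0.symm
      -- Here `c` would vanish and carry no information, but `d` is at its minimum, so its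
      -- derivative is zero.
      have hmin : IsLocalMin d t := Filter.Eventually.of_forall fun s => by
        rw [h3]; exact norm_nonneg _
      rw [hmin.hasDerivAt_eq_zero hv, h3, mul_zero]
    · set c := x t - q t (x t) with hc
      have hdc : d t = ‖c‖ := rfl
      obtain ⟨v', hv', hv'm⟩ := h2 c
      have hF := (hv.const_mul ‖c‖).sub (((hasDerivAt_const t c).inner ℝ h1).sub hv')
      -- With `c` frozen at time `t`, the gap touches `‖c‖ * d` from below at `t`, so no derivative
      -- of the projection is needed.
      have hmin : IsLocalMin ((fun s => ‖c‖ * d s) -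
          ((fun s => inner ℝ c (x s)) - fun s => supportFn (Y s) c)) t := by
        filter_upwards [Icc_mem_nhds ht.1 ht.2] with s hs
        have h3 := hlow s (hsub hs) c
        have h4 := heq t htJ
        rw [← hc, hdc] at h4
        simp only [Pi.sub_apply, hdc]
        linarith
      have h0' := hmin.hasDerivAt_eq_zero hF
      simp only [inner_zero_left, add_zero] at h0'
      have hsel := hμ t htJ (x t) (sub_ne_zero.1 (norm_pos_iff.1 h0))
      rw [← hc] at hsel
      have hqY := (hq t htJ (x t)).1
      -- The projection lies on the face exposed by `c`, so its velocity under the actual control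
      -- and disturbance belongs to `Γ`.
      have hΓ : inner ℝ c (rhs f G (q t (x t)) (μ t (x t)) (w t)) ≤
          supportFn (Gam f G W (μ t (x t)) c (Y t)) c :=
        (le_supportFn_gam_iff hf hG.continuous hW ⟨_, hw t⟩ (hY t htJ).2.1 (hY t htJ).1).2
          ⟨_, hqY, _, hw t, ((hq t htJ (x t)).supportFn_eq (hY t htJ).2.1).le, le_rfl⟩
      have hL : inner ℝ c (rhs f G (x t) (μ t (x t)) (w t)) -
          inner ℝ c (rhs f G (q t (x t)) (μ t (x t)) (w t)) ≤ ‖c‖ * (K * ‖c‖) := by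
        rw [← inner_sub_right]
        exact (real_inner_le_norm _ _).trans (mul_le_mul_of_nonneg_left
          (hK _ (hxB t htI) _ (hYB t htJ hqY) _ (hμU _ _) _ (hw t)) (norm_nonneg c))
      rw [hdc]
      refine le_of_mul_le_mul_left (a := ‖c‖) ?_ h0
      have e : ‖c‖ * ((K + 1) * ‖c‖) = ‖c‖ * (K * ‖c‖) + ‖c‖ ^ 2 := by ring
      rw [e]
      linarith
  have hda : d a = 0 := by
    have hq' := hq a ⟨ha, hab.trans hb⟩ (x a)
    have h1 : IsProj (Y a) (x a) (x a) := ⟨hxa, fun y _ => by simp⟩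
    simp only [hd]
    rw [hq'.unique h1, sub_self, norm_zero]
  intro t ht
  have h0 := eq_zero_of_ae_deriv_le (d := d) (by linarith : 0 < K + 1) (fun t _ => norm_nonneg _) hda
    hone hder t ht
  rw [sub_eq_zero.1 (norm_eq_zero.1 h0)]
  exact (hq t (hsub ht) (x t)).1

end Invariance

end MinMaxDI

/-! ### Assembly of the main theorem. -/

theorem theorem2 {nx nu nw : ℕ}
    (f : MinMaxDI.Eu nx → MinMaxDI.Eu nw → MinMaxDI.Eu nx)
    (G : MinMaxDI.Eu nx → (MinMaxDI.Eu nu →L[ℝ] MinMaxDI.Eu nx))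
    (U : Set (MinMaxDI.Eu nu)) (W : Set (MinMaxDI.Eu nw))
    (hUcompact : IsCompact U) (hUconvex : Convex ℝ U) (hUint : (interior U).Nonempty)
    (hWcompact : IsCompact W) (hWconvex : Convex ℝ W)
    (hf : Continuous (fun p : MinMaxDI.Eu nx × MinMaxDI.Eu nw => f p.1 p.2))
    (hfLip : MinMaxDI.LocLipschitzInState f)
    (hG : ContDiff ℝ 1 G)
    (t₁ t₂ : ℝ) (Y : ℝ → Set (MinMaxDI.Eu nx))
    (hY : ∀ t ∈ Icc t₁ t₂, (Y t).Nonempty ∧ IsCompact (Y t) ∧ Convex ℝ (Y t))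
    (hLip : ∀ c : MinMaxDI.Eu nx, ∃ K : NNReal,
      LipschitzOnWith K (fun t => MinMaxDI.supportFn (Y t) c) (Icc t₁ t₂))
    (hDI : ∀ᵐ t ∂(volume.restrict (Icc t₁ t₂)), ∀ c : MinMaxDI.Eu nx,
      ∃ v : ℝ, HasDerivAt (fun s => MinMaxDI.supportFn (Y s) c) v t ∧
        v ≥ MinMaxDI.minMax f G U W c (Y t)) :
    MinMaxDI.IsRFIT f G U W t₁ t₂ Y := by
  have hUne : U.Nonempty := hUint.mono interior_subset
  obtain ⟨C, hC⟩ := hUcompact.exists_bound_of_continuousOn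
    (f := fun u : MinMaxDI.Eu nu => u) continuousOn_id
  -- If this fails, there is no admissible disturbance or no interval `[a, b]`, and any constant
  -- feedback works vacuously.
  by_cases htriv : W.Nonempty ∧ t₁ ≤ t₂
  · obtain ⟨hWne, h12⟩ := htriv
    have hV : ∀ c, ContinuousOn (fun t => MinMaxDI.supportFn (Y t) c) (Icc t₁ t₂) := fun c => by
      obtain ⟨K, hK⟩ := hLip c
      exact hK.continuousOn
    obtain ⟨R, hR⟩ := MinMaxDI.exists_tube_bound (fun t ht => (hY t ht).2.1) hV
    -- Freezing the tube at its end values outside `[t₁, t₂]` makes it continuous in all of time, so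
    -- the feedback is measurable on the whole space.
    set Y' : ℝ → Set (MinMaxDI.Eu nx) := fun t => Y (projIcc t₁ t₂ h12 t) with hY'def
    have hYY' : ∀ t ∈ Icc t₁ t₂, Y' t = Y t := fun t ht => by
      simp only [hY'def, projIcc_of_mem h12 ht]
    have hY' : ∀ t, (Y' t).Nonempty ∧ IsCompact (Y' t) ∧ Convex ℝ (Y' t) := fun t =>
      hY _ (projIcc t₁ t₂ h12 t).2
    have hV' : ∀ c, Continuous fun t => MinMaxDI.supportFn (Y' t) c := fun c =>
      (hV c).comp_continuous (continuous_subtype_val.comp continuous_projIcc)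
        fun t => (projIcc t₁ t₂ h12 t).2
    choose q hq using fun t x => MinMaxDI.exists_isProj (hY' t).2.1 (hY' t).1 (hY' t).2.2 x
    obtain ⟨μ, hμm, hμU, hμ⟩ := MinMaxDI.exists_measurable_feedback hf hG.continuous hUcompact hUne
      hWcompact hWne hY' hV' (fun t => hR _ (projIcc t₁ t₂ h12 t).2) hq
    refine ⟨μ, hμm, (MinMaxDI.locallyIntegrable_of_measurable_of_bound hμm
      fun p => hC _ (hμU p.1 p.2)).locallyIntegrableOn _, fun t _ x => hμU t x, ?_⟩
    intro w hw a b ha hab hb x hx hxa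
    refine MinMaxDI.mem_tube_of_isSolution hf hfLip hG hUcompact hUne hWcompact hY hLip hDI hR
      (q := q) (fun t ht x => ?_) hμU (fun t ht x hne => ?_) hw.2 ha hab hb hx hxa
    · rw [← hYY' t ht]
      exact hq t x
    · rw [← hYY' t ht]
      exact hμ t x hne
  · obtain ⟨u, hu⟩ := hUne
    refine ⟨fun _ _ => u, measurable_const, (locallyIntegrable_const u).locallyIntegrableOn _,
      fun _ _ _ => hu, ?_⟩
    intro w hw a b ha hab hb
    exact absurd ⟨⟨w a, hw.2 a⟩, ha.trans (hab.trans hb)⟩ htriv
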